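/- Let $\Bbbk$ be an algebraically closed field of arbitrary characteristic, let $n \ge 0$, and let $X, Y \subset \mathbb{A}^n = \Bbbk^n$ be affine varieties, i.e. Zariski closed subsets, not necessarily irreducible. For closed $X', Y' \subset \mathbb{A}^n$, let the Minkowski sum $X'+Y'$ be the Zariski closure of $\{p+q \mid p\in X',\ q\in Y'\}$ in $\mathbb{A}^n$. Then $X$ and $Y$ in general position satisfy the expected dimension formula: there is a nonempty Zariski open subset $U$ of the group $\mathrm{Aff}_n = \Bbbk^n \rtimes GL_n(\Bbbk)$ of invertible affine transformations of $\mathbb{A}^n$ such that for every $g \in U$, $$\dim(gX+Y) = \min\{\dim X+\dim Y,\ n\}.$$ (Here $\dim$ is the Krull dimension of the coordinate ring, with $\dim\emptyset=-\infty$.) -/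

import Mathlib

open scoped Pointwise

noncomputable section

namespace MinkowskiVar

variable {K : Type*} [Field K] {σ : Type*}

/-- Zariski closed subsets of the affine space `σ → K`: common zero loci of polynomials.
They need not be irreducible. -/
def IsAlgebraicSet (X : Set (σ → K)) : Prop :=
  ∃ I : Ideal (MvPolynomial σ K), X = MvPolynomial.zeroLocus K I

/-- The Zariski closure `V(I(S))`; see `isLeast_zariskiClosure`. -/
def zariskiClosure (S : Set (σ → K)) : Set (σ → K) :=
  MvPolynomial.zeroLocus K (MvPolynomial.vanishingIdeal K S)

/-- `zariskiClosure S` is the smallest algebraic set containing `S`. -/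
theorem isLeast_zariskiClosure (S : Set (σ → K)) :
    IsLeast {Z : Set (σ → K) | IsAlgebraicSet Z ∧ S ⊆ Z} (zariskiClosure S) := by
  refine ⟨⟨⟨_, rfl⟩, MvPolynomial.zeroLocus_vanishingIdeal_le S⟩, ?_⟩
  rintro Z ⟨⟨I, rfl⟩, hS⟩
  exact MvPolynomial.zeroLocus_anti_mono
    (MvPolynomial.le_zeroLocus_iff_le_vanishingIdeal.mp hS)

/-- The dimension of an algebraic set: the Krull dimension of its coordinate ring
`K[x] / I(X)`. The empty set has dimension `⊥`, i.e. `-∞`. -/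
def dim (X : Set (σ → K)) : WithBot ℕ∞ :=
  ringKrullDim (MvPolynomial σ K ⧸ (MvPolynomial.vanishingIdeal K X : Ideal (MvPolynomial σ K)))

/-- The Minkowski sum: the Zariski closure of `{p + q | p ∈ X, q ∈ Y}`. -/
def minkowskiSum (X Y : Set (σ → K)) : Set (σ → K) :=
  zariskiClosure (X + Y)

/-- The group of invertible affine transformations of affine `n`-space. -/
abbrev Aff (K : Type*) [Field K] (n : ℕ) : Type _ :=
  (Fin n → K) ≃ᵃ[K] (Fin n → K)

/-- The transformation `x ↦ A x + v` as the point `(A, v)` of affine `(n² + n)`-space. -/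
def Aff.coords {n : ℕ} (g : Aff K n) : (Fin n × Fin n) ⊕ Fin n → K :=
  Sum.elim (fun p => LinearMap.toMatrix' (g.linear : (Fin n → K) →ₗ[K] (Fin n → K)) p.1 p.2)
    (g 0)

/-- Zariski open subsets of the affine group, which carries the subspace topology of
affine `(n² + n)`-space (it is the principal open subset `det A ≠ 0`). -/
def Aff.IsZariskiOpen {n : ℕ} (U : Set (Aff K n)) : Prop :=
  ∃ Z : Set ((Fin n × Fin n) ⊕ Fin n → K), IsAlgebraicSet Z ∧ U = Aff.coords ⁻¹' Zᶜ

end MinkowskiVar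

end

open scoped Pointwise

noncomputable section

namespace MinkowskiVar

/-! ### Krull dimension along integral ring maps. -/

section Integral

/-! Let `X`, `Y` be nonempty, of dimensions `d`, `e`, and put `s = d + e`. The map `(x, y) ↦ g x +
y` embeds the coordinate ring of `g X + Y` in that of `X × Y`, which has dimension `s`; this bounds
the dimension of the sum by `s`, and the coordinates bound it by `n`. For the lower bound, `min s n`
algebraically independent functions on the sum are needed.

They come from linear Noether normalization. `Normalizes` is a filtered form of finiteness: with `L`
the functions of degree at most one, it forces the ring to be integral over the chosen elements, and
for finite families with affine linear parameters it is an open condition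
(`Normalizes.exists_polynomial`). Over an infinite field, `s` linear forms on `X × Y` satisfy it,
and by openness they can be taken so that the first `min s n` are rows of `A x + B y` with `A`, `B`
invertible. For `g₀ = B⁻¹ A` this is `B (g₀ x + y)`, so those rows are pulled back from `g₀ X + Y`.

Replacing `g₀` by `g` in these rows keeps the family normalizing on a Zariski open neighbourhood of
`g₀`. There, `s` elements over which a ring of dimension `s` is integral must be independent, hence
so are the `min s n` functions on the sum. -/

theorem ringKrullDim_le_of_isIntegral {A B : Type*} [CommRing A] [CommRing B] (f : A →+* B)
    (hf : f.IsIntegral) : ringKrullDim B ≤ ringKrullDim A := by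
  algebraize [f]
  refine Order.krullDim_le_of_strictMono (PrimeSpectrum.comap f) fun P Q hPQ => ?_
  exact Ideal.IsIntegral.comap_lt_comap (R := A) (I := P.asIdeal) (J := Q.asIdeal) hPQ

theorem ringKrullDim_eq_of_isIntegral_of_injective {A B : Type*} [CommRing A] [CommRing B]
    (f : A →+* B) (hf : f.IsIntegral) (hinj : Function.Injective f) :
    ringKrullDim B = ringKrullDim A := by
  refine le_antisymm (ringKrullDim_le_of_isIntegral f hf) ?_
  algebraize [f]
  refine iSup_le fun l => ?_
  -- Lying over lifts the bottom prime of the chain, and going up lifts the rest without changing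
  -- the length.
  obtain ⟨Q, -, hQ, hQl⟩ := Ideal.exists_ideal_over_prime_of_isIntegral (S := B)
    l.head.asIdeal ⊥ (by
      have : Ideal.comap (algebraMap A B) ⊥ = ⊥ := Ideal.comap_bot_of_injective _ hinj
      rw [this]; exact bot_le)
  have : Q.LiesOver l.head.asIdeal := ⟨hQl.symm⟩
  obtain ⟨L', hL', -⟩ := Ideal.exists_ltSeries_of_hasGoingUp l Q
  rw [← hL']
  exact le_iSup (fun l : LTSeries (PrimeSpectrum B) => ((l.length : ℕ∞) : WithBot ℕ∞)) L'

end Integral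

/-! ### Counting algebraically independent elements. -/

section AlgIndep

variable {K R : Type*} [Field K] [CommRing R] [Algebra K R]

theorem ringKrullDim_mvPolynomial_fin (s : ℕ) :
    ringKrullDim (MvPolynomial (Fin s) K) = s := by
  simp

theorem ringKrullDim_eq_of_isIntegral_of_algebraicIndependent {s : ℕ} (a : Fin s → R)
    (ha : (MvPolynomial.aeval a : MvPolynomial (Fin s) K →ₐ[K] R).toRingHom.IsIntegral)
    (hind : AlgebraicIndependent K a) : ringKrullDim R = s := by
  rw [ringKrullDim_eq_of_isIntegral_of_injective _ ha hind, ringKrullDim_mvPolynomial_fin]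

/-- A nonzero relation would make the image of the polynomial ring have dimension less than `s`, yet
`R` is integral over that image. -/
theorem algebraicIndependent_of_isIntegral_of_ringKrullDim {s : ℕ} (a : Fin s → R)
    (ha : (MvPolynomial.aeval a : MvPolynomial (Fin s) K →ₐ[K] R).toRingHom.IsIntegral)
    (hdim : ringKrullDim R = s) : AlgebraicIndependent K a := by
  rw [algebraicIndependent_iff]
  intro f hf
  by_contra hne
  let φ := (MvPolynomial.aeval a : MvPolynomial (Fin s) K →ₐ[K] R).toRingHom
  have h1 : ringKrullDim φ.range + 1 ≤ ringKrullDim (MvPolynomial (Fin s) K) :=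
    ringKrullDim_succ_le_of_surjective φ.rangeRestrict φ.rangeRestrict_surjective
      (mem_nonZeroDivisors_of_ne_zero hne) (Subtype.ext hf)
  have h2 : ringKrullDim R ≤ ringKrullDim φ.range := by
    refine ringKrullDim_le_of_isIntegral φ.range.subtype fun x => ?_
    obtain ⟨p, hp, hpx⟩ := ha x
    refine ⟨p.map φ.rangeRestrict, hp.map _, ?_⟩
    rw [Polynomial.eval₂_map]
    exact hpx
  rw [ringKrullDim_mvPolynomial_fin] at h1
  have h3 : ((s : WithBot ℕ∞)) + 1 ≤ s := by
    rw [hdim] at h2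
    exact (add_le_add_left h2 1).trans h1
  have h4 : ((s + 1 : ℕ) : WithBot ℕ∞) ≤ (s : ℕ) := by exact_mod_cast h3
  have h5 : s + 1 ≤ s := by exact_mod_cast h4
  omega

theorem card_le_of_algebraicIndependent_of_isIntegral {s m : ℕ} (a : Fin s → R) (b : Fin m → R)
    (ha : (MvPolynomial.aeval a : MvPolynomial (Fin s) K →ₐ[K] R).toRingHom.IsIntegral)
    (hb : AlgebraicIndependent K b) : m ≤ s := by
  -- `R` need not be a domain. A prime contracting to zero keeps `b` independent in the domain `R ⧸
  -- P`, where transcendence degree applies.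
  obtain ⟨P, hP, hPb⟩ := Ideal.exists_comap_eq_of_mem_minimalPrimes_of_injective
    (f := (MvPolynomial.aeval b : MvPolynomial (Fin m) K →ₐ[K] R).toRingHom) hb ⊥
    (by rw [IsDomain.minimalPrimes_eq_singleton_bot]; rfl)
  let π := Ideal.Quotient.mkₐ K P
  have hb' : AlgebraicIndependent K (π ∘ b) := by
    rw [algebraicIndependent_iff]
    intro f hf
    rw [← Ideal.mem_bot, ← hPb, Ideal.mem_comap]
    rw [← Ideal.Quotient.eq_zero_iff_mem]
    have : MvPolynomial.aeval (π ∘ b) f = π (MvPolynomial.aeval b f) := by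
      rw [← AlgHom.comp_apply, MvPolynomial.comp_aeval]; rfl
    rw [this] at hf
    exact hf
  have hint : Algebra.IsIntegral (Algebra.adjoin K (Set.range (π ∘ a))) (R ⧸ P) := by
    refine ⟨fun x => ?_⟩
    obtain ⟨y, rfl⟩ := Ideal.Quotient.mkₐ_surjective K P x
    obtain ⟨p, hp, hpy⟩ := ha y
    let ψ : MvPolynomial (Fin s) K →ₐ[K] Algebra.adjoin K (Set.range (π ∘ a)) :=
      MvPolynomial.aeval fun i => ⟨π (a i), Algebra.subset_adjoin ⟨i, rfl⟩⟩
    have hψ : ((algebraMap (Algebra.adjoin K (Set.range (π ∘ a))) (R ⧸ P)).comp ψ.toRingHom) =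
        π.toRingHom.comp (MvPolynomial.aeval a : MvPolynomial (Fin s) K →ₐ[K] R).toRingHom := by
      have : (Subalgebra.val _).comp ψ = π.comp (MvPolynomial.aeval a) :=
        MvPolynomial.algHom_ext fun i => by simp [ψ]
      exact congrArg AlgHom.toRingHom this
    refine ⟨p.map ψ.toRingHom, hp.map _, ?_⟩
    rw [Polynomial.eval₂_map, hψ]
    have := congrArg π hpy
    rw [map_zero] at this
    rw [← this]
    exact (Polynomial.hom_eval₂ p _ π.toRingHom y).symm
  have h1 := hb'.lift_cardinalMk_le_trdeg
  have h2 := Algebra.IsAlgebraic.trdeg_le_cardinalMk K (Set.range (π ∘ a))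
  have h3 : Cardinal.mk (Set.range (π ∘ a)) ≤ s := by
    have := Cardinal.mk_range_le_lift (f := π ∘ a)
    simpa using this
  have h4 : Algebra.trdeg K (R ⧸ P) ≤ s := h2.trans h3
  have h5 : (m : Cardinal) ≤ Algebra.trdeg K (R ⧸ P) := by simpa using h1
  exact_mod_cast h5.trans h4

end AlgIndep

/-! ### Linear Noether normalization through filtrations. -/

section Normalizes

variable {K R ι : Type*} [Field K] [CommRing R] [Algebra K R]

/-- Elements `a i` normalize the filtration `L ^ k` of an algebra if, in high degree, multiplying
by the `a i` exhausts the filtration up to lower order terms. -/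
def Normalizes (L : Submodule K R) (a : ι → R) : Prop :=
  ∃ D : ℕ, L ^ (D + 1) ≤ (1 ⊔ Submodule.span K (Set.range a)) * L ^ D

theorem pow_add_le_of_pow_succ_le {L H : Submodule K R} {D : ℕ}
    (h : L ^ (D + 1) ≤ H * L ^ D) (k : ℕ) : L ^ (D + k) ≤ H ^ k * L ^ D := by
  induction k with
  | zero => simp
  | succ k ih =>
    calc L ^ (D + (k + 1)) = L ^ k * L ^ (D + 1) := by rw [← pow_add]; congr 1; omega
      _ ≤ L ^ k * (H * L ^ D) := by gcongr
      _ = H * L ^ (D + k) := by rw [pow_add, mul_left_comm, mul_comm (L ^ k)]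
      _ ≤ H * (H ^ k * L ^ D) := by gcongr
      _ = H ^ (k + 1) * L ^ D := by rw [pow_succ', mul_assoc]

/-- Iterating the inclusion shows that a finite generating set of `L ^ D` generates `R` as a module
over the polynomial ring. -/
theorem Normalizes.isIntegral_aeval {L : Submodule K R} {a : ι → R} (h : Normalizes L a)
    (hone : 1 ≤ L) (hfg : L.FG) (htop : ∀ x, ∃ k, x ∈ L ^ k) :
    (MvPolynomial.aeval a : MvPolynomial ι K →ₐ[K] R).toRingHom.IsIntegral := by
  obtain ⟨D, hD⟩ := h
  let φ := (MvPolynomial.aeval a : MvPolynomial ι K →ₐ[K] R)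
  let _ : Algebra (MvPolynomial ι K) R := φ.toRingHom.toAlgebra
  have hsm : ∀ (p : MvPolynomial ι K) (x : R), p • x = φ p * x := fun p x => rfl
  have : IsScalarTower K (MvPolynomial ι K) R :=
    IsScalarTower.of_algebraMap_eq fun r => (φ.commutes r).symm
  obtain ⟨F, hF⟩ := hfg.pow D
  let N : Submodule (MvPolynomial ι K) R := Submodule.span _ (F : Set R)
  have hLN : L ^ D ≤ N.restrictScalars K := by
    rw [← hF]
    exact Submodule.span_le_restrictScalars K _ _
  have hHN : (1 ⊔ Submodule.span K (Set.range a)) * N.restrictScalars K ≤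
      N.restrictScalars K := by
    rw [Submodule.sup_mul, one_mul, sup_le_iff]
    refine ⟨le_rfl, ?_⟩
    rw [Submodule.mul_le]
    intro m hm x hx
    induction hm using Submodule.span_induction with
    | mem y hy =>
      obtain ⟨i, rfl⟩ := hy
      have := N.smul_mem (MvPolynomial.X i) hx
      rw [hsm] at this
      simpa [φ] using this
    | zero => simp
    | add y z _ _ hy hz => rw [add_mul]; exact add_mem hy hz
    | smul r y _ hy => rw [smul_mul_assoc]; exact Submodule.smul_mem _ r hy
  have hHk : ∀ k : ℕ, (1 ⊔ Submodule.span K (Set.range a)) ^ k * N.restrictScalars K ≤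
      N.restrictScalars K := by
    intro k
    induction k with
    | zero => simp
    | succ k ih =>
      rw [pow_succ, mul_assoc]
      exact (by gcongr : _ ≤ _ * _).trans ih
  have hN : N = ⊤ := by
    refine eq_top_iff.2 fun x _ => ?_
    obtain ⟨k, hk⟩ := htop x
    have h1 : L ^ k ≤ L ^ (D + k) := pow_le_pow_right₀ hone (by omega)
    have h2 := pow_add_le_of_pow_succ_le hD k
    have h3 : L ^ k ≤ N.restrictScalars K :=
      (h1.trans h2).trans ((by gcongr : _ ≤ _ * _).trans (hHk k))
    exact h3 hk
  have : Module.Finite (MvPolynomial ι K) R := ⟨⟨F, hN⟩⟩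
  exact fun x => Algebra.IsIntegral.isIntegral (R := MvPolynomial ι K) x

/-- Modulo `E` every `a i` is `γ i • b`, so a monomial becomes its value at `γ` times a power of
`b`; each error term has one factor in `E`. -/
theorem aeval_monomial_sub_mem {a : ι → R} (b : R) (γ : ι → K) {E H : Submodule K R}
    (hE : ∀ i, a i - γ i • b ∈ E) (hH : ∀ i, a i ∈ H) (hb : b ∈ H) (d : ι →₀ ℕ) (r : K) :
    MvPolynomial.aeval a (MvPolynomial.monomial d r) -
      MvPolynomial.eval γ (MvPolynomial.monomial d r) • b ^ d.degree ∈
        E * H ^ (d.degree - 1) := by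
  by_cases hr : r = 0
  · simp [hr]
  suffices h : ∀ (d : ι →₀ ℕ) (r : K), ∃ j, (MvPolynomial.monomial d r).IsHomogeneous j ∧
      MvPolynomial.aeval a (MvPolynomial.monomial d r) -
        MvPolynomial.eval γ (MvPolynomial.monomial d r) • b ^ j ∈ E * H ^ (j - 1) by
    obtain ⟨j, hj, hmem⟩ := h d r
    rwa [hj.inj_right (MvPolynomial.isHomogeneous_monomial r rfl) (by simpa using hr)] at hmem
  refine MvPolynomial.induction_on_monomial (motive := fun p => ∃ j, p.IsHomogeneous j ∧
    MvPolynomial.aeval a p - MvPolynomial.eval γ p • b ^ j ∈ E * H ^ (j - 1)) ?_ ?_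
  · intro c
    exact ⟨0, MvPolynomial.isHomogeneous_C _ _, by simp [Algebra.smul_def]⟩
  · rintro p i ⟨j, hj, hmem⟩
    refine ⟨j + 1, hj.mul (MvPolynomial.isHomogeneous_X _ _), ?_⟩
    have key : MvPolynomial.aeval a (p * MvPolynomial.X i) -
        MvPolynomial.eval γ (p * MvPolynomial.X i) • b ^ (j + 1) =
        (MvPolynomial.aeval a p - MvPolynomial.eval γ p • b ^ j) * a i +
          (a i - γ i • b) * (MvPolynomial.eval γ p • b ^ j) := by
      simp only [map_mul, MvPolynomial.aeval_X, MvPolynomial.eval_X, Algebra.smul_def]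
      ring
    rw [key, Nat.add_sub_cancel]
    refine add_mem ?_ (Submodule.mul_mem_mul (hE i)
      (Submodule.smul_mem _ _ (Submodule.pow_mem_pow _ hb j)))
    -- For `j = 0` the exponent `j - 1` truncates and `hmem` is too weak, but the difference of
    -- constants is exactly zero.
    cases j with
    | zero =>
      have h0 : MvPolynomial.aeval a p - MvPolynomial.eval γ p • b ^ 0 = 0 := by
        have : p = MvPolynomial.C (p.coeff 0) :=
          MvPolynomial.totalDegree_eq_zero_iff_eq_C.1 (Nat.le_zero.1 hj.totalDegree_le)
        rw [this]
        simp [Algebra.smul_def]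
      rw [h0, zero_mul]
      exact zero_mem _
    | succ j =>
      rw [pow_succ, ← mul_assoc]
      exact Submodule.mul_mem_mul hmem (hH i)

theorem aeval_monomial_mem_pow {a : ι → R} {H : Submodule K R} (hH : ∀ i, a i ∈ H)
    (d : ι →₀ ℕ) (r : K) :
    MvPolynomial.aeval a (MvPolynomial.monomial d r) ∈ H ^ d.degree := by
  have h := aeval_monomial_sub_mem (a := a) 0 0 (E := H) (H := H) (by simpa using hH) hH
    (zero_mem _) d r
  rcases Nat.eq_zero_or_pos d.degree with h0 | hpos
  · have : d = 0 := (Finsupp.degree_eq_zero_iff d).1 h0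
    subst this
    simp
  · rw [zero_pow hpos.ne', smul_zero, sub_zero, ← pow_succ', Nat.sub_add_cancel hpos] at h
    exact h

theorem aeval_sub_eval_homogeneousComponent_mem {a : ι → R} (b : R) (γ : ι → K)
    {E H : Submodule K R} (hE : ∀ i, a i - γ i • b ∈ E) (hH : ∀ i, a i ∈ H) (hb : b ∈ H)
    (hone : 1 ≤ H) {e : ℕ} {f : MvPolynomial ι K} (hf : f.totalDegree ≤ e + 1) :
    MvPolynomial.aeval a f -
      MvPolynomial.eval γ (MvPolynomial.homogeneousComponent (e + 1) f) • b ^ (e + 1) ∈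
        (1 ⊔ E) * H ^ e := by
  classical
  rw [MvPolynomial.homogeneousComponent_apply]
  nth_rewrite 1 [f.as_sum]
  rw [map_sum, map_sum, Finset.sum_smul, Finset.sum_filter, ← Finset.sum_sub_distrib]
  refine Submodule.sum_mem _ fun d hd => ?_
  split_ifs with hde
  · have := aeval_monomial_sub_mem b γ hE hH hb d (f.coeff d)
    rw [hde] at this
    exact mul_le_mul_left (le_sup_right : E ≤ 1 ⊔ E) (H ^ e) this
  · have hlt : d.degree ≤ e := by
      have := (MvPolynomial.le_totalDegree hd).trans hf
      change d.degree ≤ _ at this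
      omega
    have h2 := aeval_monomial_mem_pow hH d (f.coeff d)
    rw [sub_zero]
    refine mul_le_mul_left (le_sup_left : 1 ≤ 1 ⊔ E) (H ^ e) ?_
    rw [one_mul]
    exact pow_le_pow_right₀ hone hlt h2

/-- On expanding the product, every term other than a multiple of `b ^ (j + 1)` has a factor in
`H'`. -/
theorem pow_succ_le_mul_pow_sup_span {H H' : Submodule K R} {b : R}
    (hb : b ∈ H) (h : H ≤ H' ⊔ Submodule.span K {b}) (j : ℕ) :
    H ^ (j + 1) ≤ H' * H ^ j ⊔ Submodule.span K {b ^ (j + 1)} := by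
  induction j with
  | zero => simpa using h
  | succ j ih =>
    calc H ^ (j + 1 + 1) = H ^ (j + 1) * H := pow_succ _ _
      _ ≤ (H' * H ^ j ⊔ Submodule.span K {b ^ (j + 1)}) * H := by gcongr
      _ = H' * H ^ (j + 1) ⊔ Submodule.span K {b ^ (j + 1)} * H := by
        rw [Submodule.sup_mul, mul_assoc, ← pow_succ]
      _ ≤ H' * H ^ (j + 1) ⊔ Submodule.span K {b ^ (j + 1)} * (H' ⊔ Submodule.span K {b}) := by
        gcongr
      _ ≤ _ := by
        rw [Submodule.mul_sup, Submodule.span_mul_span, Set.singleton_mul_singleton, ← pow_succ,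
          ← sup_assoc]
        refine sup_le_sup_right (sup_le le_rfl ?_) _
        rw [mul_comm]
        gcongr
        rw [Submodule.span_singleton_le_iff_mem]
        exact Submodule.pow_mem_pow _ hb _

/-- Pick `c` where the leading form `g` of the relation is nonzero and subtract multiples of `b = a
k / c k` so that all `a i - c i • b` lie in the new span. The relation then puts `g(c) b ^ (e + 1)`
in lower terms, making `b` dispensable. -/
theorem Normalizes.exists_of_aeval_eq_zero [Infinite K] [Nontrivial R] {L : Submodule K R}
    (hone : 1 ≤ L) {s : ℕ} {a : Fin (s + 1) → R} (haL : ∀ i, a i ∈ L) (h : Normalizes L a)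
    {f : MvPolynomial (Fin (s + 1)) K} (hf : f ≠ 0) (hfa : MvPolynomial.aeval a f = 0) :
    ∃ a' : Fin s → R, (∀ i, a' i ∈ L) ∧ Normalizes L a' := by
  obtain ⟨D, hD⟩ := h
  obtain ⟨e, he⟩ : ∃ e, f.totalDegree = e + 1 := by
    refine Nat.exists_eq_succ_of_ne_zero fun h0 => ?_
    rw [MvPolynomial.totalDegree_eq_zero_iff_eq_C] at h0
    rw [h0, MvPolynomial.aeval_C, map_eq_zero] at hfa
    rw [hfa, map_zero] at h0
    exact hf h0
  set g := MvPolynomial.homogeneousComponent (e + 1) f with hg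
  have hghom : g.IsHomogeneous (e + 1) := MvPolynomial.homogeneousComponent_isHomogeneous _ _
  have hg0 : g ≠ 0 := by
    obtain ⟨d, hd, hde⟩ := Finset.exists_mem_eq_sup f.support
      (MvPolynomial.support_nonempty.2 hf) fun d => d.sum fun _ e => e
    have hdeg : d.degree = e + 1 := hde.symm.trans he
    intro h0
    have := congrArg (MvPolynomial.coeff d) h0
    rw [hg, MvPolynomial.coeff_homogeneousComponent, if_pos hdeg] at this
    exact MvPolynomial.mem_support_iff.1 hd this
  obtain ⟨c, hc⟩ : ∃ c, MvPolynomial.eval c g ≠ 0 := by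
    by_contra! hall
    exact hg0 (MvPolynomial.funext fun x => by simpa using hall x)
  -- A form of positive degree `e + 1` vanishes at the origin, so `c ≠ 0`.
  obtain ⟨k, hk⟩ : ∃ k, c k ≠ 0 := by
    by_contra! hall
    have : c = 0 := funext hall
    subst this
    exact hc (by simp [hg, MvPolynomial.eval_zero, MvPolynomial.constantCoeff_eq,
      MvPolynomial.coeff_homogeneousComponent])
  set b := (c k)⁻¹ • a k with hb
  let a' : Fin s → R := fun i => a (k.succAbove i) - c (k.succAbove i) • b
  set E := Submodule.span K (Set.range a)
  set E' := Submodule.span K (Set.range a')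
  have haE : ∀ i, a i ∈ E := fun i => Submodule.subset_span ⟨i, rfl⟩
  have hbE : b ∈ E := Submodule.smul_mem _ _ (haE k)
  have hEL : E ≤ L := Submodule.span_le.2 (by rintro _ ⟨i, rfl⟩; exact haL i)
  have ha'E : ∀ i, a' i ∈ E := fun i => sub_mem (haE _) (Submodule.smul_mem _ _ hbE)
  have hsub : ∀ i, a i - c i • b ∈ E' := by
    intro i
    rcases Fin.eq_self_or_eq_succAbove k i with rfl | ⟨j, rfl⟩
    · rw [hb, smul_inv_smul₀ hk, sub_self]; exact zero_mem _
    · exact Submodule.subset_span ⟨j, rfl⟩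
  have hbH : b ∈ 1 ⊔ E := Submodule.mem_sup_right hbE
  have hmem := aeval_sub_eval_homogeneousComponent_mem (H := 1 ⊔ E) b c hsub
    (fun i => Submodule.mem_sup_right (haE i)) hbH le_sup_left he.le
  rw [hfa, zero_sub, neg_mem_iff, ← hg] at hmem
  have hbe : b ^ (e + 1) ∈ (1 ⊔ E') * (1 ⊔ E) ^ e := by
    have := Submodule.smul_mem _ (MvPolynomial.eval c g)⁻¹ hmem
    rwa [inv_smul_smul₀ hc] at this
  have hH : 1 ⊔ E ≤ (1 ⊔ E') ⊔ Submodule.span K {b} := by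
    refine sup_le (le_sup_left.trans le_sup_left) (Submodule.span_le.2 ?_)
    rintro _ ⟨i, rfl⟩
    have : a i = (a i - c i • b) + c i • b := by abel
    rw [this]
    exact Submodule.add_mem_sup (Submodule.mem_sup_right (hsub i))
      (Submodule.smul_mem _ _ (Submodule.mem_span_singleton_self b))
  have hpow : (1 ⊔ E) ^ (e + 1) ≤ (1 ⊔ E') * (1 ⊔ E) ^ e :=
    (pow_succ_le_mul_pow_sup_span hbH hH e).trans
      (sup_le le_rfl ((Submodule.span_singleton_le_iff_mem _ _).2 hbe))
  refine ⟨a', fun i => hEL (ha'E i), D + e, ?_⟩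
  calc L ^ (D + e + 1) ≤ (1 ⊔ E) ^ (e + 1) * L ^ D := pow_add_le_of_pow_succ_le hD (e + 1)
    _ ≤ (1 ⊔ E') * (1 ⊔ E) ^ e * L ^ D := by gcongr
    _ ≤ (1 ⊔ E') * L ^ e * L ^ D := by gcongr; exact sup_le hone hEL
    _ = (1 ⊔ E') * L ^ (D + e) := by rw [mul_assoc, ← pow_add, add_comm e]

/-- **Linear Noether normalization**: if finitely many elements of `L` normalize `L ^ k`, then so do
finitely many algebraically independent ones. -/
theorem Normalizes.exists_algebraicIndependent [Infinite K] [Nontrivial R] {L : Submodule K R}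
    (hone : 1 ≤ L) {s : ℕ} {a : Fin s → R} (haL : ∀ i, a i ∈ L) (h : Normalizes L a) :
    ∃ (t : ℕ) (a' : Fin t → R), (∀ i, a' i ∈ L) ∧ Normalizes L a' ∧
      AlgebraicIndependent K a' := by
  induction s with
  | zero => exact ⟨0, a, haL, h, by
      rw [algebraicIndependent_empty_type_iff]; exact (algebraMap K R).injective⟩
  | succ s ih =>
    by_cases hind : AlgebraicIndependent K a
    · exact ⟨s + 1, a, haL, h, hind⟩
    · rw [algebraicIndependent_iff] at hind
      push Not at hind
      obtain ⟨f, hfa, hf⟩ := hind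
      obtain ⟨a', ha'L, ha'⟩ := h.exists_of_aeval_eq_zero hone haL hf hfa
      exact ih ha'L ha'

end Normalizes

/-! ### Normalization under maps and joins. -/

section Operations

variable {K R ι κ : Type*} [Field K] [CommRing R] [Algebra K R]

theorem Normalizes.mono {L : Submodule K R} {a : ι → R} {b : κ → R} (h : Normalizes L a)
    (hab : ∀ i, a i ∈ 1 ⊔ Submodule.span K (Set.range b)) : Normalizes L b := by
  obtain ⟨D, hD⟩ := h
  refine ⟨D, hD.trans (mul_le_mul_left (sup_le le_sup_left (Submodule.span_le.2 ?_)) _)⟩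
  rintro _ ⟨i, rfl⟩
  exact hab i

theorem Normalizes.map {S : Type*} [CommRing S] [Algebra K S] {L : Submodule K R} {a : ι → R}
    (h : Normalizes L a) (φ : R →ₐ[K] S) : Normalizes (L.map φ.toLinearMap) (φ ∘ a) := by
  obtain ⟨D, hD⟩ := h
  refine ⟨D, ?_⟩
  have := Submodule.map_mono (f := φ.toLinearMap) hD
  rw [Submodule.map_mul, Submodule.map_sup, Submodule.map_pow, Submodule.map_pow,
    Submodule.map_one, Submodule.map_span, ← Set.range_comp] at this
  exact this

/-- Pigeonhole: among `p + q + 1` factors from `A` or `B`, at least `p + 1` lie in `A` or at least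
`q + 1` in `B`. -/
theorem sup_pow_le (A B : Submodule K R) (p q : ℕ) :
    (A ⊔ B) ^ (p + q + 1) ≤ A ^ (p + 1) * (A ⊔ B) ^ q ⊔ B ^ (q + 1) * (A ⊔ B) ^ p := by
  have base : ∀ q : ℕ, (A ⊔ B) ^ (q + 1) ≤ A * (A ⊔ B) ^ q ⊔ B ^ (q + 1) := by
    intro q
    induction q with
    | zero => simp
    | succ q ih =>
      calc (A ⊔ B) ^ (q + 1 + 1) = A * (A ⊔ B) ^ (q + 1) ⊔ B * (A ⊔ B) ^ (q + 1) := by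
            rw [pow_succ', Submodule.sup_mul]
        _ ≤ A * (A ⊔ B) ^ (q + 1) ⊔ B * (A * (A ⊔ B) ^ q ⊔ B ^ (q + 1)) := by gcongr
        _ ≤ _ := by
          rw [Submodule.mul_sup, ← pow_succ', ← sup_assoc]
          refine sup_le_sup_right (sup_le le_rfl ?_) _
          rw [mul_left_comm, pow_succ']
          gcongr
          exact le_sup_right
  induction p with
  | zero => simpa using base q
  | succ p ih =>
    calc (A ⊔ B) ^ (p + 1 + q + 1) = (A ⊔ B) ^ (p + q + 1) * (A ⊔ B) := by
          rw [← pow_succ]; congr 1; omega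
      _ ≤ (A ^ (p + 1) * (A ⊔ B) ^ q ⊔ B ^ (q + 1) * (A ⊔ B) ^ p) * (A ⊔ B) := by gcongr
      _ = A ^ (p + 1) * (A ⊔ B) ^ (q + 1) ⊔ B ^ (q + 1) * (A ⊔ B) ^ (p + 1) := by
          rw [Submodule.sup_mul, mul_assoc, mul_assoc, ← pow_succ, ← pow_succ]
      _ ≤ A ^ (p + 1) * (A * (A ⊔ B) ^ q ⊔ B ^ (q + 1)) ⊔ B ^ (q + 1) * (A ⊔ B) ^ (p + 1) := by
          gcongr; exact base q
      _ ≤ _ := by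
          rw [Submodule.mul_sup, ← mul_assoc, ← pow_succ, sup_assoc]
          refine sup_le_sup_left (sup_le ?_ le_rfl) _
          rw [mul_comm]
          gcongr
          exact le_sup_left

theorem Normalizes.sup {A B : Submodule K R} {a : ι → R} {b : κ → R} (ha : Normalizes A a)
    (hb : Normalizes B b) : Normalizes (A ⊔ B) (Sum.elim a b) := by
  obtain ⟨p, hp⟩ := ha
  obtain ⟨q, hq⟩ := hb
  refine ⟨p + q, (sup_pow_le A B p q).trans (sup_le ?_ ?_)⟩
  · calc A ^ (p + 1) * (A ⊔ B) ^ q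
        ≤ (1 ⊔ Submodule.span K (Set.range a)) * A ^ p * (A ⊔ B) ^ q := by gcongr
      _ ≤ (1 ⊔ Submodule.span K (Set.range (Sum.elim a b))) * (A ⊔ B) ^ p * (A ⊔ B) ^ q := by
        gcongr
        · rw [Set.Sum.elim_range]; exact Set.subset_union_left
        · exact le_sup_left
      _ = _ := by rw [mul_assoc, ← pow_add]
  · calc B ^ (q + 1) * (A ⊔ B) ^ p
        ≤ (1 ⊔ Submodule.span K (Set.range b)) * B ^ q * (A ⊔ B) ^ p := by gcongr
      _ ≤ (1 ⊔ Submodule.span K (Set.range (Sum.elim a b))) * (A ⊔ B) ^ q * (A ⊔ B) ^ p := by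
        gcongr
        · rw [Set.Sum.elim_range]; exact Set.subset_union_right
        · exact le_sup_right
      _ = _ := by rw [mul_assoc, ← pow_add, add_comm]

end Operations

/-! ### Openness of normalization in affine families. -/

section Openness

variable {K R ι τ : Type*} [Field K] [CommRing R] [Algebra K R] [Fintype τ]

/-- Families `f t` of elements of `L` depending on parameters `t` in an affine linear way. -/
def IsAffineFamily (L : Submodule K R) (f : (τ → K) → R) : Prop :=
  ∃ p ∈ L, ∃ q : τ → R, (∀ k, q k ∈ L) ∧ ∀ t, f t = p + ∑ k, t k • q k

theorem IsAffineFamily.const {L : Submodule K R} {r : R} (hr : r ∈ L) :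
    IsAffineFamily L (fun _ : τ → K => r) :=
  ⟨r, hr, 0, fun _ => zero_mem _, by simp⟩

theorem IsAffineFamily.coord {L : Submodule K R} {r : R} (hr : r ∈ L) (k : τ) :
    IsAffineFamily L (fun t : τ → K => t k • r) := by
  classical
  refine ⟨0, zero_mem _, Pi.single k r, fun j => ?_, fun t => ?_⟩
  · rcases eq_or_ne j k with rfl | h
    · simpa using hr
    · simp [Pi.single_eq_of_ne h]
  · rw [zero_add, Finset.sum_eq_single k] <;> simp +contextual [Pi.single_eq_of_ne]

theorem IsAffineFamily.add {L : Submodule K R} {f g : (τ → K) → R} (hf : IsAffineFamily L f)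
    (hg : IsAffineFamily L g) : IsAffineFamily L (fun t => f t + g t) := by
  obtain ⟨p, hp, q, hq, hfq⟩ := hf
  obtain ⟨p', hp', q', hq', hgq⟩ := hg
  refine ⟨p + p', add_mem hp hp', q + q', fun k => add_mem (hq k) (hq' k), fun t => ?_⟩
  simp only [hfq, hgq, Pi.add_apply, smul_add, Finset.sum_add_distrib]
  abel

theorem IsAffineFamily.smul {L : Submodule K R} {f : (τ → K) → R} (hf : IsAffineFamily L f)
    (r : K) : IsAffineFamily L (fun t => r • f t) := by
  obtain ⟨p, hp, q, hq, hfq⟩ := hf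
  refine ⟨r • p, L.smul_mem _ hp, r • q, fun k => L.smul_mem _ (hq k), fun t => ?_⟩
  simp only [hfq, Pi.smul_apply, smul_add, Finset.smul_sum]
  congr 1
  exact Finset.sum_congr rfl fun k _ => smul_comm _ _ _

theorem IsAffineFamily.sum {α : Type*} {L : Submodule K R} (s : Finset α)
    {f : α → (τ → K) → R} (hf : ∀ i, IsAffineFamily L (f i)) :
    IsAffineFamily L (fun t => ∑ i ∈ s, f i t) := by
  classical
  induction s using Finset.induction_on with
  | empty => simpa using IsAffineFamily.const (zero_mem L)
  | insert i s hi ih =>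
    simp only [Finset.sum_insert hi]
    exact (hf i).add ih

theorem exists_eq_add_sum_mul_of_mem [Fintype ι] {a : ι → R} {W : Submodule K R} {x : R}
    (hx : x ∈ (1 ⊔ Submodule.span K (Set.range a)) * W) :
    ∃ w₀ ∈ W, ∃ w : ι → R, (∀ i, w i ∈ W) ∧ x = w₀ + ∑ i, a i * w i := by
  induction hx using Submodule.mul_induction_on' with
  | mem_mul_mem m hm w hw =>
    obtain ⟨y, hy, z, hz, rfl⟩ := Submodule.mem_sup.1 hm
    obtain ⟨r, rfl⟩ := Submodule.mem_one.1 hy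
    obtain ⟨c, rfl⟩ := (Submodule.mem_span_range_iff_exists_fun K).1 hz
    refine ⟨r • w, W.smul_mem _ hw, fun i => c i • w, fun i => W.smul_mem _ hw, ?_⟩
    rw [add_mul, Finset.sum_mul, Algebra.smul_def]
    simp
  | add x _ y _ hx hy =>
    obtain ⟨u₀, hu₀, u, hu, rfl⟩ := hx
    obtain ⟨v₀, hv₀, v, hv, rfl⟩ := hy
    refine ⟨u₀ + v₀, add_mem hu₀ hv₀, u + v, fun i => add_mem (hu i) (hv i), ?_⟩
    simp only [Pi.add_apply, mul_add, Finset.sum_add_distrib]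
    abel

/-- Normalizing a finitely generated filtration is a Zariski open condition in affine families. -/
theorem Normalizes.exists_polynomial [Finite ι] {L : Submodule K R} (hone : 1 ≤ L) (hfg : L.FG)
    {a : (τ → K) → ι → R} (ha : ∀ i, IsAffineFamily L fun t => a t i) {t₀ : τ → K}
    (h : Normalizes L (a t₀)) :
    ∃ F : MvPolynomial τ K, MvPolynomial.eval t₀ F ≠ 0 ∧
      ∀ t, MvPolynomial.eval t F ≠ 0 → Normalizes L (a t) := by
  classical
  have := Fintype.ofFinite ι
  obtain ⟨D, hD⟩ := h
  choose p hp q hq hpq using ha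
  set V := L ^ (D + 1) with hV
  have hWV : L ^ D ≤ V := pow_le_pow_right₀ hone (by omega)
  have hLW : ∀ {x y : R}, x ∈ L → y ∈ L ^ D → x * y ∈ V := fun hx hy => by
    rw [hV, pow_succ']; exact Submodule.mul_mem_mul hx hy
  have : Module.Finite K V := Module.Finite.iff_fg.2 (hfg.pow _)
  let e := Module.finBasis K V
  -- Write a basis of `L ^ (D + 1)` through `a t₀`, then vary `t` with the coefficients `w₀`, `w`
  -- fixed. The determinant of the resulting vectors is polynomial in `t` and equals 1 at `t₀`;
  -- where it is nonzero they still span.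
  choose w₀ hw₀ w hw hdecomp using fun j => exists_eq_add_sum_mul_of_mem (hD (e j).2)
  let u₀ : Fin (Module.finrank K V) → V := fun j =>
    ⟨w₀ j + ∑ i, p i * w j i, add_mem (hWV (hw₀ j)) (sum_mem fun i _ => hLW (hp i) (hw j i))⟩
  let u : τ → Fin (Module.finrank K V) → V := fun k j =>
    ⟨∑ i, q i k * w j i, sum_mem fun i _ => hLW (hq i k) (hw j i)⟩
  let v : (τ → K) → Fin (Module.finrank K V) → V := fun t j => u₀ j + ∑ k, t k • u k j
  have hv : ∀ t j, (v t j : R) = w₀ j + ∑ i, a t i * w j i := by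
    intro t j
    simp only [v, u₀, u, hpq, add_mul, Finset.sum_add_distrib, Submodule.coe_add,
      Submodule.coe_sum, Submodule.coe_smul, Finset.smul_sum, Finset.sum_mul, add_assoc]
    congr 2
    rw [Finset.sum_comm]
    simp only [smul_mul_assoc]
  let F : MvPolynomial τ K := Matrix.det (Matrix.of fun l j =>
    MvPolynomial.C (e.repr (u₀ j) l) + ∑ k, MvPolynomial.X k * MvPolynomial.C (e.repr (u k j) l))
  have hF : ∀ t, MvPolynomial.eval t F = e.det (v t) := by
    intro t
    rw [Module.Basis.det_apply, RingHom.map_det]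
    congr 1
    ext l j
    simp [v, Module.Basis.toMatrix_apply]
  refine ⟨F, ?_, fun t ht => ⟨D, ?_⟩⟩
  · have : v t₀ = e := by
      ext j
      rw [hv, ← hdecomp]
    rw [hF, this, e.det_self]
    exact one_ne_zero
  · rw [hF] at ht
    have hspan := ((Module.Basis.is_basis_iff_det e).2 ht.isUnit).2
    have hle : (⊤ : Submodule K V) ≤
        ((1 ⊔ Submodule.span K (Set.range (a t))) * L ^ D).comap V.subtype := by
      rw [← hspan, Submodule.span_le]
      rintro _ ⟨j, rfl⟩
      change (v t j : R) ∈ (1 ⊔ Submodule.span K (Set.range (a t))) * L ^ D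
      rw [hv, Submodule.sup_mul, one_mul]
      exact Submodule.add_mem_sup (hw₀ j) (sum_mem fun i _ =>
        Submodule.mul_mem_mul (Submodule.subset_span ⟨i, rfl⟩) (hw j i))
    intro x hx
    exact hle (x := ⟨x, hx⟩) trivial

end Openness

theorem submodule_pow_le_pow {K R : Type*} [Field K] [CommRing R] [Algebra K R]
    {L : Submodule K R} (h : 1 ≤ L) {k l : ℕ} (hkl : k ≤ l) : L ^ k ≤ L ^ l :=
  pow_le_pow_right₀ h hkl

/-! ### Coordinate rings and products. -/

section CoordRing

variable {K σ τ : Type*} [Field K]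

/-- The coordinate ring of (the closure of) a subset of affine space. -/
abbrev CoordRing (S : Set (σ → K)) : Type _ :=
  MvPolynomial σ K ⧸ (MvPolynomial.vanishingIdeal K S : Ideal (MvPolynomial σ K))

/-- The coordinate functions. -/
def coordFun (S : Set (σ → K)) (i : σ) : CoordRing S :=
  Ideal.Quotient.mkₐ K _ (MvPolynomial.X i)

/-- The functions of degree at most one. -/
def affineForms (S : Set (σ → K)) : Submodule K (CoordRing S) :=
  1 ⊔ Submodule.span K (Set.range (coordFun S))

theorem one_le_affineForms (S : Set (σ → K)) : 1 ≤ affineForms S := le_sup_left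

theorem coordFun_mem_affineForms (S : Set (σ → K)) (i : σ) : coordFun S i ∈ affineForms S :=
  Submodule.mem_sup_right (Submodule.subset_span ⟨i, rfl⟩)

theorem one_mem_affineForms (S : Set (σ → K)) : 1 ∈ affineForms S :=
  Submodule.one_le.1 (one_le_affineForms S)

theorem affineForms_fg [Finite σ] (S : Set (σ → K)) : (affineForms S).FG := by
  refine Submodule.FG.sup ?_ (Submodule.fg_span (Set.finite_range _))
  rw [Submodule.one_eq_span]
  exact Submodule.fg_span_singleton 1

theorem exists_mem_affineForms_pow (S : Set (σ → K)) (x : CoordRing S) :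
    ∃ k, x ∈ affineForms S ^ k := by
  obtain ⟨p, rfl⟩ := Ideal.Quotient.mkₐ_surjective K _ x
  induction p using MvPolynomial.induction_on with
  | C r => exact ⟨0, by
      rw [pow_zero]
      exact Submodule.mem_one.2 ⟨r, ((Ideal.Quotient.mkₐ K _).commutes r).symm⟩⟩
  | add p q hp hq =>
    obtain ⟨k, hk⟩ := hp
    obtain ⟨l, hl⟩ := hq
    have h1 : affineForms S ^ k ≤ affineForms S ^ (k + l) :=
      submodule_pow_le_pow (one_le_affineForms S) (Nat.le_add_right k l)
    have h2 : affineForms S ^ l ≤ affineForms S ^ (k + l) :=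
      submodule_pow_le_pow (one_le_affineForms S) (Nat.le_add_left l k)
    refine ⟨k + l, ?_⟩
    rw [map_add]
    exact add_mem (h1 hk) (h2 hl)
  | mul_X p i hp =>
    obtain ⟨k, hk⟩ := hp
    refine ⟨k + 1, ?_⟩
    rw [map_mul, pow_succ]
    exact Submodule.mul_mem_mul hk (coordFun_mem_affineForms S i)

theorem normalizes_coordFun (S : Set (σ → K)) : Normalizes (affineForms S) (coordFun S) :=
  ⟨0, by simp [affineForms]⟩

theorem Normalizes.isIntegral_aeval_coordRing [Finite σ] {ι : Type*} {S : Set (σ → K)}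
    {a : ι → CoordRing S} (h : Normalizes (affineForms S) a) :
    (MvPolynomial.aeval a : MvPolynomial ι K →ₐ[K] CoordRing S).toRingHom.IsIntegral :=
  h.isIntegral_aeval (one_le_affineForms S) (affineForms_fg S) (exists_mem_affineForms_pow S)

theorem nontrivial_coordRing {S : Set (σ → K)} (hS : S.Nonempty) : Nontrivial (CoordRing S) := by
  rw [Ideal.Quotient.nontrivial_iff, Ideal.ne_top_iff_one]
  obtain ⟨x, hx⟩ := hS
  intro h
  simpa using h x hx

theorem exists_normalizes_algebraicIndependent [Infinite K] {n : ℕ} {S : Set (Fin n → K)}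
    (hS : S.Nonempty) : ∃ (d : ℕ) (a : Fin d → CoordRing S), (∀ i, a i ∈ affineForms S) ∧
      Normalizes (affineForms S) a ∧ AlgebraicIndependent K a :=
  have := nontrivial_coordRing hS
  (normalizes_coordFun S).exists_algebraicIndependent (one_le_affineForms S)
    (coordFun_mem_affineForms S)

theorem dim_eq_of_normalizes [Finite σ] {S : Set (σ → K)} {d : ℕ} {a : Fin d → CoordRing S}
    (h : Normalizes (affineForms S) a) (hind : AlgebraicIndependent K a) : dim S = d :=
  ringKrullDim_eq_of_isIntegral_of_algebraicIndependent a h.isIntegral_aeval_coordRing hind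

theorem dim_zariskiClosure (S : Set (σ → K)) : dim (zariskiClosure S) = dim S := by
  have : MvPolynomial.vanishingIdeal K (zariskiClosure S) = MvPolynomial.vanishingIdeal K S :=
    MvPolynomial.zeroLocus_vanishingIdeal_galoisConnection.u_l_u_eq_u S
  unfold dim
  rw [this]

theorem dim_empty : dim (∅ : Set (σ → K)) = ⊥ := by
  unfold dim
  rw [MvPolynomial.vanishingIdeal_empty]
  exact ringKrullDim_eq_bot_of_subsingleton

/-- Pullback of functions along the polynomial map `γ` from `S` to `T`. -/
def pullback {S : Set (σ → K)} {T : Set (τ → K)} (γ : τ → MvPolynomial σ K)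
    (h : ∀ x ∈ S, (fun j => MvPolynomial.aeval x (γ j)) ∈ T) : CoordRing T →ₐ[K] CoordRing S :=
  Ideal.Quotient.liftₐ _ ((Ideal.Quotient.mkₐ K _).comp (MvPolynomial.aeval γ)) fun p hp => by
    refine Ideal.Quotient.eq_zero_iff_mem.2 fun x hx => ?_
    have := hp _ (h x hx)
    rwa [← MvPolynomial.comp_aeval_apply] at this

theorem pullback_mk {S : Set (σ → K)} {T : Set (τ → K)} (γ : τ → MvPolynomial σ K)
    (h : ∀ x ∈ S, (fun j => MvPolynomial.aeval x (γ j)) ∈ T) (p : MvPolynomial τ K) :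
    pullback γ h (Ideal.Quotient.mkₐ K _ p) =
      Ideal.Quotient.mkₐ K _ (MvPolynomial.aeval γ p) :=
  rfl

theorem pullback_coordFun {S : Set (σ → K)} {T : Set (τ → K)} (γ : τ → MvPolynomial σ K)
    (h : ∀ x ∈ S, (fun j => MvPolynomial.aeval x (γ j)) ∈ T) (j : τ) :
    pullback γ h (coordFun T j) = Ideal.Quotient.mkₐ K _ (γ j) := by
  rw [coordFun, pullback_mk, MvPolynomial.aeval_X]

theorem pullback_injective {S : Set (σ → K)} {T : Set (τ → K)} (γ : τ → MvPolynomial σ K)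
    (h : ∀ x ∈ S, (fun j => MvPolynomial.aeval x (γ j)) ∈ T)
    (hsurj : ∀ y ∈ T, ∃ x ∈ S, (fun j => MvPolynomial.aeval x (γ j)) = y) :
    Function.Injective (pullback γ h) := by
  rw [injective_iff_map_eq_zero]
  intro p hp
  obtain ⟨p, rfl⟩ := Ideal.Quotient.mkₐ_surjective K _ p
  rw [pullback_mk] at hp
  refine Ideal.Quotient.eq_zero_iff_mem.2 fun y hy => ?_
  obtain ⟨x, hx, rfl⟩ := hsurj y hy
  have := Ideal.Quotient.eq_zero_iff_mem.1 hp x hx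
  rwa [MvPolynomial.comp_aeval_apply] at this

/-- The value of a function at a point of `S`. -/
def evalAt {S : Set (σ → K)} (x : S) : CoordRing S →ₐ[K] K :=
  Ideal.Quotient.liftₐ _ (MvPolynomial.aeval x.1) fun _ hp => hp x.1 x.2

theorem evalAt_mk {S : Set (σ → K)} (x : S) (p : MvPolynomial σ K) :
    evalAt x (Ideal.Quotient.mkₐ K _ p) = MvPolynomial.aeval x.1 p :=
  rfl

theorem eq_zero_of_evalAt {S : Set (σ → K)} {f : CoordRing S} (h : ∀ x : S, evalAt x f = 0) :
    f = 0 := by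
  obtain ⟨p, rfl⟩ := Ideal.Quotient.mkₐ_surjective K _ f
  exact Ideal.Quotient.eq_zero_iff_mem.2 fun x hx => h ⟨x, hx⟩

/-- The product of two sets of points. -/
def prodSet (X : Set (σ → K)) (Y : Set (τ → K)) : Set (σ ⊕ τ → K) :=
  {z | z ∘ Sum.inl ∈ X ∧ z ∘ Sum.inr ∈ Y}

/-- Pullback of functions along the first projection. -/
def pullbackFst (X : Set (σ → K)) (Y : Set (τ → K)) : CoordRing X →ₐ[K] CoordRing (prodSet X Y) :=
  pullback (fun i => MvPolynomial.X (Sum.inl i)) fun z hz => by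
    simpa [Function.comp_def] using hz.1

/-- Pullback of functions along the second projection. -/
def pullbackSnd (X : Set (σ → K)) (Y : Set (τ → K)) : CoordRing Y →ₐ[K] CoordRing (prodSet X Y) :=
  pullback (fun i => MvPolynomial.X (Sum.inr i)) fun z hz => by
    simpa [Function.comp_def] using hz.2

theorem evalAt_pullbackFst {X : Set (σ → K)} {Y : Set (τ → K)} (x : X) (y : Y)
    (h : Sum.elim x.1 y.1 ∈ prodSet X Y) (f : CoordRing X) :
    evalAt ⟨Sum.elim x.1 y.1, h⟩ (pullbackFst X Y f) = evalAt x f := by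
  obtain ⟨p, rfl⟩ := Ideal.Quotient.mkₐ_surjective K _ f
  rw [pullbackFst, pullback_mk, evalAt_mk, evalAt_mk, MvPolynomial.comp_aeval_apply]
  simp

theorem evalAt_pullbackSnd {X : Set (σ → K)} {Y : Set (τ → K)} (x : X) (y : Y)
    (h : Sum.elim x.1 y.1 ∈ prodSet X Y) (f : CoordRing Y) :
    evalAt ⟨Sum.elim x.1 y.1, h⟩ (pullbackSnd X Y f) = evalAt y f := by
  obtain ⟨p, rfl⟩ := Ideal.Quotient.mkₐ_surjective K _ f
  rw [pullbackSnd, pullback_mk, evalAt_mk, evalAt_mk, MvPolynomial.comp_aeval_apply]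
  simp

theorem affineForms_prodSet (X : Set (σ → K)) (Y : Set (τ → K)) :
    affineForms (prodSet X Y) = (affineForms X).map (pullbackFst X Y).toLinearMap ⊔
      (affineForms Y).map (pullbackSnd X Y).toLinearMap := by
  have h1 : pullbackFst X Y ∘ coordFun X = coordFun (prodSet X Y) ∘ Sum.inl :=
    funext fun i => pullback_coordFun _ _ i
  have h2 : pullbackSnd X Y ∘ coordFun Y = coordFun (prodSet X Y) ∘ Sum.inr :=
    funext fun i => pullback_coordFun _ _ i
  simp only [affineForms, Submodule.map_sup, Submodule.map_one, Submodule.map_span,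
    AlgHom.coe_toLinearMap, ← Set.range_comp, h1, h2]
  rw [sup_sup_sup_comm, sup_idem, ← Submodule.span_union, ← Set.Sum.elim_range,
    Sum.elim_comp_inl_inr]

/-- Specialize a relation at a point of `X`: independence of `b` frees the second block of
variables. Fixing that block arbitrarily, independence of `a` frees the first, so the relation
vanishes everywhere. -/
theorem algebraicIndependent_prodSet [Infinite K] {ι κ : Type*} {X : Set (σ → K)}
    {Y : Set (τ → K)} {a : ι → CoordRing X} {b : κ → CoordRing Y}
    (ha : AlgebraicIndependent K a) (hb : AlgebraicIndependent K b) :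
    AlgebraicIndependent K (Sum.elim (pullbackFst X Y ∘ a) (pullbackSnd X Y ∘ b)) := by
  rw [algebraicIndependent_iff] at ha hb ⊢
  intro f hf
  have hxy : ∀ (x : X) (y : Y), MvPolynomial.eval
      (Sum.elim (fun i => evalAt x (a i)) (fun j => evalAt y (b j))) f = 0 := by
    intro x y
    have h : Sum.elim x.1 y.1 ∈ prodSet X Y := by simp [prodSet]
    have := congrArg (evalAt ⟨_, h⟩) hf
    rw [map_zero, MvPolynomial.comp_aeval_apply] at this
    rw [← this, MvPolynomial.aeval_eq_eval]
    congr 2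
    funext i
    rcases i with i | i
    · exact (evalAt_pullbackFst x y h (a i)).symm
    · exact (evalAt_pullbackSnd x y h (b i)).symm
  have hxv : ∀ (x : X) (v : κ → K), MvPolynomial.eval
      (Sum.elim (fun i => evalAt x (a i)) v) f = 0 := by
    intro x v
    let fx : MvPolynomial κ K := MvPolynomial.aeval
      (Sum.elim (fun i => MvPolynomial.C (evalAt x (a i))) MvPolynomial.X) f
    have hfx : ∀ w, MvPolynomial.aeval w fx =
        MvPolynomial.eval (Sum.elim (fun i => evalAt x (a i)) w) f := by
      intro w
      rw [MvPolynomial.comp_aeval_apply, MvPolynomial.aeval_eq_eval]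
      congr 2
      funext i
      rcases i with i | i <;> simp
    have hfx0 : fx = 0 := by
      refine hb fx (eq_zero_of_evalAt fun y => ?_)
      rw [MvPolynomial.comp_aeval_apply, hfx, hxy]
    rw [← hfx, hfx0, map_zero]
  refine MvPolynomial.funext fun z => ?_
  rw [map_zero]
  let fz : MvPolynomial ι K := MvPolynomial.aeval
    (Sum.elim MvPolynomial.X (fun j => MvPolynomial.C (z (Sum.inr j)))) f
  have hfz : ∀ w, MvPolynomial.aeval w fz =
      MvPolynomial.eval (Sum.elim w (z ∘ Sum.inr)) f := by
    intro w
    rw [MvPolynomial.comp_aeval_apply, MvPolynomial.aeval_eq_eval]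
    congr 2
    funext i
    rcases i with i | i <;> simp
  have hfz0 : fz = 0 := by
    refine ha fz (eq_zero_of_evalAt fun x => ?_)
    rw [MvPolynomial.comp_aeval_apply, hfz, hxv]
  have := hfz (z ∘ Sum.inl)
  rw [hfz0, map_zero, Sum.elim_comp_inl_inr] at this
  exact this.symm

/-- Noether normalization of a product by linear forms. -/
theorem exists_normalizes_prodSet [Infinite K] [Finite σ] [Finite τ] {d e : ℕ} {X : Set (σ → K)}
    {Y : Set (τ → K)} {a : Fin d → CoordRing X} {b : Fin e → CoordRing Y}
    (haL : ∀ i, a i ∈ affineForms X) (hbL : ∀ i, b i ∈ affineForms Y)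
    (ha : Normalizes (affineForms X) a) (hb : Normalizes (affineForms Y) b)
    (hai : AlgebraicIndependent K a) (hbi : AlgebraicIndependent K b) :
    dim (prodSet X Y) = ((d + e : ℕ) : WithBot ℕ∞) ∧
    ∃ c : Fin (d + e) → CoordRing (prodSet X Y),
      (∀ i, c i ∈ Submodule.span K (Set.range (coordFun (prodSet X Y)))) ∧
      Normalizes (affineForms (prodSet X Y)) c := by
  set S := prodSet X Y
  let c₀ : Fin (d + e) → CoordRing S :=
    Sum.elim (pullbackFst X Y ∘ a) (pullbackSnd X Y ∘ b) ∘ finSumFinEquiv.symm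
  have hc₀L : ∀ i, c₀ i ∈ affineForms S := by
    intro i
    rw [affineForms_prodSet]
    simp only [c₀, Function.comp_apply]
    rcases finSumFinEquiv.symm i with j | j
    · exact Submodule.mem_sup_left ⟨a j, haL j, rfl⟩
    · exact Submodule.mem_sup_right ⟨b j, hbL j, rfl⟩
  have hc₀ : Normalizes (affineForms S) c₀ := by
    rw [affineForms_prodSet]
    refine ((ha.map (pullbackFst X Y)).sup (hb.map (pullbackSnd X Y))).mono fun i => ?_
    exact Submodule.mem_sup_right (Submodule.subset_span ⟨finSumFinEquiv i, by simp [c₀]⟩)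
  have hind : AlgebraicIndependent K c₀ :=
    (algebraicIndependent_prodSet hai hbi).comp _ finSumFinEquiv.symm.injective
  refine ⟨dim_eq_of_normalizes hc₀ hind, ?_⟩
  -- Drop the constant terms; the summand `1` in `Normalizes` absorbs them.
  choose y hy z hz hyz using fun i => Submodule.mem_sup.1 (hc₀L i)
  refine ⟨z, hz, hc₀.mono fun i => ?_⟩
  rw [← hyz i]
  exact Submodule.add_mem_sup (hy i) (Submodule.subset_span ⟨i, rfl⟩)

end CoordRing

/-! ### Forms with invertible coefficient blocks. -/

section GenericForms

variable {K R : Type*} [Field K] [Infinite K] [CommRing R] [Algebra K R] {n s : ℕ}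

/-- If some linear forms in `2 n` elements normalize a filtration, then so do forms whose
coefficient rows are rows of two invertible matrices. -/
theorem exists_normalizes_of_isUnit_det {L : Submodule K R} (hone : 1 ≤ L) (hfg : L.FG)
    {x : Fin n ⊕ Fin n → R} (hx : ∀ c, x c ∈ L) {a : Fin s → R}
    (ha : ∀ i, a i ∈ Submodule.span K (Set.range x)) (h : Normalizes L a) :
    ∃ (A B : Matrix (Fin n) (Fin n) K) (C : Fin s → Fin n ⊕ Fin n → K),
      A.det ≠ 0 ∧ B.det ≠ 0 ∧
      (∀ (i : Fin s) (hi : i.1 < n) (j : Fin n),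
        C i (Sum.inl j) = A ⟨i, hi⟩ j ∧ C i (Sum.inr j) = B ⟨i, hi⟩ j) ∧
      Normalizes L fun i => ∑ c, C i c • x c := by
  choose lam hlam using fun i => (Submodule.mem_span_range_iff_exists_fun K).1 (ha i)
  -- A coefficient matrix with `s + n` rows treats `s < n` and `s ≥ n` alike: the forms use its
  -- first `s` rows, the two square blocks its first `n`.
  let ofForm : Fin s → Fin (s + n) := Fin.castLE (Nat.le_add_right s n)
  let ofRow : Fin n → Fin (s + n) := Fin.castLE (Nat.le_add_left n s)
  let form : (Fin (s + n) × (Fin n ⊕ Fin n) → K) → Fin s → R :=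
    fun T i => ∑ c, T (ofForm i, c) • x c
  let T₀ : Fin (s + n) × (Fin n ⊕ Fin n) → K :=
    fun r => if hr : r.1.1 < s then lam ⟨r.1, hr⟩ r.2 else 0
  have hT₀ : form T₀ = a := by
    funext i
    simp only [form, T₀, ofForm, Fin.val_castLE, Fin.is_lt, dite_true, Fin.eta, hlam]
  obtain ⟨F, hF₀, hF⟩ := Normalizes.exists_polynomial hone hfg (a := form)
    (fun i => IsAffineFamily.sum _ fun c => IsAffineFamily.coord (hx c) _) (t₀ := T₀)
    (by rw [hT₀]; exact h)
  let side : (Fin n → Fin n ⊕ Fin n) → MvPolynomial (Fin (s + n) × (Fin n ⊕ Fin n)) K :=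
    fun ε => Matrix.det (Matrix.of fun i j => MvPolynomial.X (ofRow i, ε j))
  have hside : ∀ ε T, MvPolynomial.eval T (side ε) =
      Matrix.det (Matrix.of fun i j => T (ofRow i, ε j)) := by
    intro ε T
    rw [RingHom.map_det]
    congr 1
    ext i j
    simp
  have hside₀ : ∀ ε, Function.Injective ε → side ε ≠ 0 := by
    classical
    intro ε hε h0
    -- At this point the chosen block is the identity matrix, so its determinant is a nonzero
    -- polynomial.
    have := hside ε fun r => if ∃ i, r = (ofRow i, ε i) then 1 else 0
    rw [h0, map_zero] at this
    have hone : (Matrix.of fun i j =>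
        if ∃ k, ((ofRow i, ε j) : Fin (s + n) × (Fin n ⊕ Fin n)) = (ofRow k, ε k)
          then (1 : K) else 0) = 1 := by
      ext i j
      rw [Matrix.of_apply, Matrix.one_apply]
      congr 1
      simp only [Prod.mk.injEq, eq_iff_iff]
      constructor
      · rintro ⟨k, hk, hk'⟩
        rw [hε hk', (Fin.castLE_injective _ hk : i = k)]
      · rintro rfl
        exact ⟨i, rfl, rfl⟩
    rw [hone, Matrix.det_one] at this
    exact zero_ne_one this
  have hF0 : F ≠ 0 := by
    rintro rfl
    simp at hF₀
  have hprod : F * side Sum.inl * side Sum.inr ≠ 0 :=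
    mul_ne_zero (mul_ne_zero hF0 (hside₀ _ Sum.inl_injective)) (hside₀ _ Sum.inr_injective)
  obtain ⟨T, hT⟩ : ∃ T, MvPolynomial.eval T (F * side Sum.inl * side Sum.inr) ≠ 0 := by
    by_contra! hall
    exact hprod (MvPolynomial.funext fun T => by rw [hall T, map_zero])
  rw [map_mul, map_mul, hside, hside] at hT
  refine ⟨_, _, fun i c => T (ofForm i, c), right_ne_zero_of_mul (left_ne_zero_of_mul hT),
    right_ne_zero_of_mul hT, fun i hi j => ⟨rfl, rfl⟩,
    hF T (left_ne_zero_of_mul (left_ne_zero_of_mul hT))⟩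

end GenericForms

/-! ### The addition map and generic Minkowski sums. -/

section Sum

variable {K : Type*} [Field K] {n : ℕ}

/-- The components of `(x, y) ↦ A x + v + y`, with `(A, v)` given by its coordinates `t`. -/
def addComponent (t : (Fin n × Fin n) ⊕ Fin n → K) (j : Fin n) :
    MvPolynomial (Fin n ⊕ Fin n) K :=
  ∑ k, t (Sum.inl (j, k)) • MvPolynomial.X (Sum.inl k) + t (Sum.inr j) • 1 +
    MvPolynomial.X (Sum.inr j)

theorem aeval_addComponent (g : Aff K n) (z : Fin n ⊕ Fin n → K) :
    (fun j => MvPolynomial.aeval z (addComponent g.coords j)) =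
      g (z ∘ Sum.inl) + z ∘ Sum.inr := by
  have hg : g (z ∘ Sum.inl) = g.linear (z ∘ Sum.inl) + g 0 := by
    have := g.map_vadd 0 (z ∘ Sum.inl)
    simpa using this
  funext j
  have hlin : g.linear (z ∘ Sum.inl) j =
      ∑ k, LinearMap.toMatrix' (g.linear : (Fin n → K) →ₗ[K] (Fin n → K)) j k *
        z (Sum.inl k) :=
    (congrFun (LinearMap.toMatrix'_mulVec
      (g.linear : (Fin n → K) →ₗ[K] (Fin n → K)) (z ∘ Sum.inl)) j).symm
  rw [hg, Pi.add_apply, Pi.add_apply, hlin]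
  simp [addComponent, Aff.coords]

/-- Pullback of functions along `(x, y) ↦ g x + y`. -/
def pullbackAdd (g : Aff K n) (X Y : Set (Fin n → K)) :
    CoordRing (g '' X + Y) →ₐ[K] CoordRing (prodSet X Y) :=
  pullback (addComponent g.coords) fun z hz => by
    rw [aeval_addComponent]
    exact Set.add_mem_add ⟨_, hz.1, rfl⟩ hz.2

theorem pullbackAdd_injective (g : Aff K n) (X Y : Set (Fin n → K)) :
    Function.Injective (pullbackAdd g X Y) := by
  refine pullback_injective _ _ ?_
  rintro _ ⟨_, ⟨x, hx, rfl⟩, y, hy, rfl⟩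
  exact ⟨Sum.elim x y, ⟨hx, hy⟩, by rw [aeval_addComponent]; rfl⟩

theorem pullbackAdd_coordFun (g : Aff K n) (X Y : Set (Fin n → K)) (j : Fin n) :
    pullbackAdd g X Y (coordFun _ j) =
      ∑ k, g.coords (Sum.inl (j, k)) • coordFun (prodSet X Y) (Sum.inl k) +
        g.coords (Sum.inr j) • 1 + coordFun (prodSet X Y) (Sum.inr j) := by
  rw [pullbackAdd, pullback_coordFun, addComponent]
  simp only [map_add, map_sum, map_smul, map_one]
  rfl

/-- The dimension of a Minkowski sum, given normalizing forms on the product that extend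
linear forms on the sum. -/
theorem dim_minkowskiSum_eq [Infinite K] {X Y : Set (Fin n → K)} (hX : X.Nonempty)
    (hY : Y.Nonempty) {s : ℕ} (hdim : dim (prodSet X Y) = s) (g : Aff K n)
    {a : Fin s → CoordRing (prodSet X Y)} (ha : Normalizes (affineForms (prodSet X Y)) a)
    {b : Fin (min s n) → CoordRing (g '' X + Y)}
    (hab : ∀ i, pullbackAdd g X Y (b i) = a (Fin.castLE (min_le_left s n) i)) :
    dim (minkowskiSum (g '' X) Y) = ((min s n : ℕ) : WithBot ℕ∞) := by
  rw [minkowskiSum, dim_zariskiClosure]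
  obtain ⟨w, c, -, hc, hci⟩ := exists_normalizes_algebraicIndependent ((hX.image g).add hY)
  rw [dim_eq_of_normalizes hc hci]
  have haint := ha.isIntegral_aeval_coordRing
  have hai : AlgebraicIndependent K a :=
    algebraicIndependent_of_isIntegral_of_ringKrullDim a haint hdim
  have hbi : AlgebraicIndependent K b := by
    rw [← AlgHom.algebraicIndependent_iff _ (pullbackAdd_injective g X Y)]
    convert hai.comp _ (Fin.castLE_injective (min_le_left s n)) using 1
    exact funext hab
  have h1 : w ≤ s := card_le_of_algebraicIndependent_of_isIntegral a _ haint
    (hci.map' (pullbackAdd_injective g X Y))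
  have h2 : w ≤ n := card_le_of_algebraicIndependent_of_isIntegral _ c
    (normalizes_coordFun _).isIntegral_aeval_coordRing hci
  have h3 : min s n ≤ w :=
    card_le_of_algebraicIndependent_of_isIntegral c b hc.isIntegral_aeval_coordRing hbi
  rw [le_antisymm (le_min h1 h2) h3]

/-- The affine transformation with an invertible matrix as linear part that fixes the origin. -/
theorem exists_coords_eq {M : Matrix (Fin n) (Fin n) K} (hM : M.det ≠ 0) :
    ∃ g : Aff K n, (∀ j k, g.coords (Sum.inl (j, k)) = M j k) ∧
      ∀ j, g.coords (Sum.inr j) = 0 := by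
  have := M.invertibleOfIsUnitDet hM.isUnit
  refine ⟨(Matrix.toLinearEquiv' M this).toAffineEquiv, fun j k => ?_, fun j => ?_⟩
  · change LinearMap.toMatrix' (Matrix.toLin' M) j k = M j k
    rw [LinearMap.toMatrix'_toLin']
  · change Matrix.toLin' M 0 j = 0
    rw [map_zero]
    rfl

theorem isZariskiOpen_eval_ne_zero (G : MvPolynomial ((Fin n × Fin n) ⊕ Fin n) K) :
    Aff.IsZariskiOpen {g : Aff K n | MvPolynomial.eval g.coords G ≠ 0} := by
  refine ⟨_, ⟨Ideal.span {G}, rfl⟩, ?_⟩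
  ext g
  simp [MvPolynomial.zeroLocus_span, MvPolynomial.aeval_eq_eval]

theorem exists_isZariskiOpen_dim_minkowskiSum [Infinite K] {X Y : Set (Fin n → K)}
    (hX : X.Nonempty) (hY : Y.Nonempty) :
    ∃ U : Set (Aff K n), Aff.IsZariskiOpen U ∧ U.Nonempty ∧
      ∀ g ∈ U, dim (minkowskiSum (g '' X) Y) = min (dim X + dim Y) (n : WithBot ℕ∞) := by
  obtain ⟨d, a, haL, ha, hai⟩ := exists_normalizes_algebraicIndependent hX
  obtain ⟨e, b, hbL, hb, hbi⟩ := exists_normalizes_algebraicIndependent hY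
  obtain ⟨hdim, c, hcL, hc⟩ := exists_normalizes_prodSet haL hbL ha hb hai hbi
  rw [dim_eq_of_normalizes ha hai, dim_eq_of_normalizes hb hbi]
  set S := prodSet X Y
  obtain ⟨A, B, C, hA, hB, hC, hnorm⟩ := exists_normalizes_of_isUnit_det (one_le_affineForms S)
    (affineForms_fg S) (coordFun_mem_affineForms S) hcL hc
  -- The first `min (d + e) n` forms are rows of `B (g x + y)`, hence functions on the sum for every
  -- `g`; any remaining ones stay fixed.
  let form : ((Fin n × Fin n) ⊕ Fin n → K) → Fin (d + e) → CoordRing S := fun t i =>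
    if hi : i.1 < n then ∑ j, B ⟨i, hi⟩ j •
      (∑ k, t (Sum.inl (j, k)) • coordFun S (Sum.inl k) + t (Sum.inr j) • (1 : CoordRing S) +
        coordFun S (Sum.inr j))
    else ∑ c, C i c • coordFun S c
  have hform : ∀ i, IsAffineFamily (affineForms S) fun t => form t i := by
    intro i
    by_cases hi : i.1 < n
    · simp only [form, hi, dite_true]
      refine IsAffineFamily.sum _ fun j => IsAffineFamily.smul ?_ _
      refine (IsAffineFamily.add (IsAffineFamily.sum _ fun k => ?_) ?_).add ?_
      · exact IsAffineFamily.coord (coordFun_mem_affineForms S _) _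
      · exact IsAffineFamily.coord (one_mem_affineForms S) _
      · exact IsAffineFamily.const (coordFun_mem_affineForms S _)
    · simp only [form, hi, dite_false]
      exact IsAffineFamily.const (sum_mem fun c _ =>
        Submodule.smul_mem _ _ (coordFun_mem_affineForms S c))
  have hM : (B⁻¹ * A).det ≠ 0 := by
    rw [Matrix.det_mul, Matrix.det_nonsing_inv, Ring.inverse_eq_inv']
    exact mul_ne_zero (inv_ne_zero hB) hA
  obtain ⟨g₀, hg₀, hg₀'⟩ := exists_coords_eq hM
  have hform₀ : form g₀.coords = fun i => ∑ c, C i c • coordFun S c := by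
    funext i
    by_cases hi : i.1 < n
    · have hBM : B * (B⁻¹ * A) = A := Matrix.mul_nonsing_inv_cancel_left _ _ hB.isUnit
      simp only [form, hi, dite_true, hg₀, hg₀', zero_smul, smul_zero, smul_add,
        Finset.sum_add_distrib, Finset.sum_const_zero, add_zero, Fintype.sum_sum_type, hC i hi]
      congr 1
      simp only [Finset.smul_sum, smul_smul]
      rw [Finset.sum_comm]
      refine Finset.sum_congr rfl fun k _ => ?_
      rw [← Finset.sum_smul]
      congr 1
      conv_rhs => rw [← hBM, Matrix.mul_apply]
    · simp only [form, hi, dite_false]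
  obtain ⟨G, hG₀, hG⟩ := Normalizes.exists_polynomial (one_le_affineForms S) (affineForms_fg S)
    hform (t₀ := g₀.coords) (by rw [hform₀]; exact hnorm)
  refine ⟨_, isZariskiOpen_eval_ne_zero G, ⟨g₀, hG₀⟩, fun g hg => ?_⟩
  rw [dim_minkowskiSum_eq hX hY hdim g (hG _ hg)
    (b := fun i => ∑ j, B ⟨i, i.2.trans_le (min_le_right _ _)⟩ j • coordFun _ j)]
  · rfl
  · intro i
    have hi : i.1 < n := i.2.trans_le (min_le_right _ _)
    simp only [form, Fin.val_castLE, hi, dite_true, map_sum, map_smul, pullbackAdd_coordFun]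
    rfl

end Sum

end MinkowskiVar

end

theorem theorem3p9 {K : Type*} [Field K] [IsAlgClosed K] (n : ℕ) (X Y : Set (Fin n → K))
    (hX : MinkowskiVar.IsAlgebraicSet X) (hY : MinkowskiVar.IsAlgebraicSet Y) :
    ∃ U : Set (MinkowskiVar.Aff K n), MinkowskiVar.Aff.IsZariskiOpen U ∧ U.Nonempty ∧
      ∀ g ∈ U, MinkowskiVar.dim (MinkowskiVar.minkowskiSum (g '' X) Y) =
        min (MinkowskiVar.dim X + MinkowskiVar.dim Y) (n : WithBot ℕ∞) := by
  by_cases h : X.Nonempty ∧ Y.Nonempty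
  · exact MinkowskiVar.exists_isZariskiOpen_dim_minkowskiSum h.1 h.2
  -- If one set is empty, so is the sum, and both sides are `⊥`; the polynomial 1 gives the whole
  -- group.
  · refine ⟨_, MinkowskiVar.isZariskiOpen_eval_ne_zero 1, ⟨AffineEquiv.refl K _, by simp⟩,
      fun g _ => ?_⟩
    rw [MinkowskiVar.minkowskiSum, MinkowskiVar.dim_zariskiClosure]
    rw [not_and_or, Set.not_nonempty_iff_eq_empty, Set.not_nonempty_iff_eq_empty] at h
    rcases h with rfl | rfl <;> simp [MinkowskiVar.dim_empty]
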